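/- Let $p_1,p_2,p_3\in\mathbb{R}^2$ be the vertices of an equilateral triangle, let $L_i(t)=\frac12(p_i+t)$ for $i=1,2,3$, and let $SG$ be the Sierpiński gasket, that is, the unique nonempty compact set with $SG=\bigcup_{i=1}^{3}L_i(SG)$. Let $N\ge 1$ and, for a word $\omega=\omega_1\cdots\omega_N\in\{1,2,3\}^N$, let $L_\omega=L_{\omega_1}\circ\cdots\circ L_{\omega_N}$. Let $f,b:SG\to\mathbb{R}$ and $\alpha_\omega:SG\to\mathbb{R}$ ($\omega\in\{1,2,3\}^N$) be functions such that $f$, $b$ and all the $\alpha_\omega$ are Hölder continuous, with exponents $\sigma_f,\sigma_b,\sigma_\alpha\in(0,1]$ and constants $K_f,K_b,K_\alpha$ respectively, and such that $b(p_j)=f(p_j)$ for $j=1,2,3$ and $\|\alpha_\omega\|_\infty=\sup_{SG}|\alpha_\omega|<1$ for every $\omega$. Put $$\sigma=\min\{\sigma_f,\sigma_b,\sigma_\alpha\},\qquad \alpha_{\max}=\max_{\omega}\|\alpha_\omega\|_\infty,\qquad \alpha_{\min}=\min_{\omega}\|\alpha_\omega\|_\infty,\qquad \tilde\gamma=\sum_{\omega\in\{1,2,3\}^N}\|\alpha_\omega\|_\infty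 .$$ Let $f^\alpha$ be the $\alpha$-fractal function on $SG$, i.e. the continuous function $f^\alpha:SG\to\mathbb{R}$ with $$f^{\alpha}(t)=f(t)+\alpha_\omega(L_\omega^{-1}(t))\,f^\alpha(L_\omega^{-1}(t))-\alpha_\omega(L_\omega^{-1}(t))\,b(L_\omega^{-1}(t))\qquad\text{for all } t\in L_\omega(SG),\ \omega\in\{1,2,3\}^N,$$ and let $Gr(f^\alpha)=\{(t,f^\alpha(t)):t\in SG\}\subset\mathbb{R}^3$. For a nonempty bounded $A\subset\mathbb{R}^3$ let $N_\delta(A)$ be the number of cubes $\prod_i[m_i\delta,(m_i+1)\delta]$, $m\in\mathbb{Z}^3$, that intersect $A$, and let $\underline{\dim}_B A$ and $\overline{\dim}_B A$ be the lower and upper limits of $\log N_\delta(A)/(-\log\delta)$ as $\delta\to0^+$. Then the following hold. (1) If $\alpha_{\min}>\dfrac{1}{2^{N\sigma}}$, then $$\frac{\log 3}{\log 2}\le\dim_H Gr(f^\alpha)\le\underline{\dim}_B Gr(f^\alpha)\le\overline{\dim}_B Gr(f^\alpha)\le 1+\frac{\log\tilde\gamma}{N\log 2}.$$ (2) If $\dfrac{1}{2^{N\sigma}}<\alpha_{\max}<1$,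 then $$\frac{\log 3}{\log 2}\le\dim_H Gr(f^\alpha)\le\underline{\dim}_B Gr(f^\alpha)\le\overline{\dim}_B Gr(f^\alpha)\le 1+\frac{\log(3^N\alpha_{\max})}{N\log 2}.$$ -/

import Mathlib

open Filter Topology Set
open scoped NNReal

noncomputable section

/-- The Euclidean plane. -/
abbrev Plane : Type := EuclideanSpace ℝ (Fin 2)

namespace SG

/-- `p 0, p 1, p 2` are the vertices of a (nondegenerate) equilateral triangle. -/
def IsEquilateral (p : Fin 3 → Plane) : Prop :=
  ∃ s : ℝ, 0 < s ∧ ∀ i j, i ≠ j → dist (p i) (p j) = s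

/-- The contraction `L_i(t) = (p_i + t) / 2`. -/
def L (p : Fin 3 → Plane) (i : Fin 3) (t : Plane) : Plane := (1 / 2 : ℝ) • (p i + t)

/-- `L_ω = L_{ω_1} ∘ ⋯ ∘ L_{ω_N}` for a word `ω` of length `N`. -/
def wordMap (p : Fin 3 → Plane) {N : ℕ} (ω : Fin N → Fin 3) (t : Plane) : Plane :=
  (List.ofFn ω).foldr (L p) t

/-- The point with address `w`, that is, the limit of `L_{w_0} ∘ ⋯ ∘ L_{w_n} (t)`. -/
def point (p : Fin 3 → Plane) (w : ℕ → Fin 3) : Plane :=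
  ∑' k : ℕ, ((1 / 2 : ℝ) ^ (k + 1)) • p (w k)

/-- The Sierpinski gasket with vertices `p 0, p 1, p 2`: the set of all points with an address.
By `gasket_nonempty`, `isCompact_gasket`, `gasket_eq_iUnion` and `eq_gasket` below it is the
attractor of the iterated function system `L_0, L_1, L_2`, the unique nonempty compact set `K`
with `K = ⋃ i, L_i(K)`. -/
def gasket (p : Fin 3 → Plane) : Set Plane := range (point p)

theorem summable_bound (C : ℝ) : Summable fun k : ℕ => (1 / 2 : ℝ) ^ (k + 1) * C := by
  have h : Summable fun k : ℕ => (1 / 2 : ℝ) ^ k :=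
    summable_geometric_of_lt_one (by norm_num) (by norm_num)
  exact ((summable_nat_add_iff 1).2 h).mul_right C

theorem norm_term_le (p : Fin 3 → Plane) (w : ℕ → Fin 3) (k : ℕ) :
    ‖((1 / 2 : ℝ) ^ (k + 1)) • p (w k)‖ ≤ (1 / 2 : ℝ) ^ (k + 1) * ∑ i, ‖p i‖ := by
  rw [norm_smul, Real.norm_of_nonneg (by positivity)]
  exact mul_le_mul_of_nonneg_left
    (Finset.single_le_sum (f := fun i => ‖p i‖) (fun i _ => norm_nonneg _) (Finset.mem_univ _))
    (by positivity)

theorem summable_term (p : Fin 3 → Plane) (w : ℕ → Fin 3) :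
    Summable fun k : ℕ => ((1 / 2 : ℝ) ^ (k + 1)) • p (w k) :=
  Summable.of_norm_bounded (summable_bound _) (norm_term_le p w)

theorem point_eq (p : Fin 3 → Plane) (w : ℕ → Fin 3) :
    point p w = L p (w 0) (point p fun k => w (k + 1)) := by
  unfold point L
  rw [(summable_term p w).tsum_eq_zero_add, smul_add, ← tsum_const_smul'']
  congr 1
  · simp
  · refine tsum_congr fun k => ?_
    rw [smul_smul]
    congr 1
    ring

theorem gasket_nonempty (p : Fin 3 → Plane) : (gasket p).Nonempty := range_nonempty _

theorem isCompact_gasket (p : Fin 3 → Plane) : IsCompact (gasket p) := by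
  refine isCompact_range ?_
  refine continuous_tsum (fun k => ?_) (summable_bound (∑ i, ‖p i‖))
    (fun k w => norm_term_le p w k)
  have h : Continuous fun w : ℕ → Fin 3 => p (w k) :=
    Continuous.comp (g := p) continuous_of_discreteTopology (continuous_apply k)
  exact h.const_smul ((1 / 2 : ℝ) ^ (k + 1))

theorem gasket_eq_iUnion (p : Fin 3 → Plane) : gasket p = ⋃ i, L p i '' gasket p := by
  ext x
  simp only [mem_iUnion, mem_image]
  constructor
  · rintro ⟨w, rfl⟩
    exact ⟨w 0, _, ⟨_, rfl⟩, (point_eq p w).symm⟩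
  · rintro ⟨i, _, ⟨w, rfl⟩, rfl⟩
    exact ⟨fun k => Nat.casesOn k i w, point_eq p _⟩

theorem dist_L (p : Fin 3 → Plane) (i : Fin 3) (x y : Plane) :
    dist (L p i x) (L p i y) = 1 / 2 * dist x y := by
  rw [L, L, dist_smul₀, dist_add_left]
  norm_num

theorem subset_of_eq_iUnion (p : Fin 3 → Plane) {A B : Set Plane} (hA : IsCompact A)
    (hB : IsCompact B) (hB' : B.Nonempty) (hAL : A = ⋃ i, L p i '' A)
    (hBL : B = ⋃ i, L p i '' B) : A ⊆ B := by
  obtain ⟨D, hD⟩ := (hA.union hB).isBounded.subset_closedBall (0 : Plane)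
  have key : ∀ n : ℕ, ∀ x ∈ A, ∃ y ∈ B, dist x y ≤ (1 / 2 : ℝ) ^ n * (D + D) := by
    intro n
    induction n with
    | zero =>
      intro x hx
      obtain ⟨y, hy⟩ := hB'
      refine ⟨y, hy, ?_⟩
      have h1 := Metric.mem_closedBall.1 (hD (Or.inl hx))
      have h2 := Metric.mem_closedBall.1 (hD (Or.inr hy))
      have h3 := dist_triangle_right x y 0
      simp only [pow_zero, one_mul]
      linarith
    | succ n ih =>
      intro x hx
      rw [hAL] at hx
      obtain ⟨i, x', hx', rfl⟩ := mem_iUnion.1 hx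
      obtain ⟨y, hy, hxy⟩ := ih x' hx'
      refine ⟨L p i y, ?_, ?_⟩
      · rw [hBL]
        exact mem_iUnion.2 ⟨i, y, hy, rfl⟩
      · rw [dist_L, pow_succ]
        linarith
  intro x hx
  rw [← hB.isClosed.closure_eq, Metric.mem_closure_iff]
  intro ε hε
  have ht : Tendsto (fun n : ℕ => (1 / 2 : ℝ) ^ n * (D + D)) atTop (𝓝 (0 * (D + D))) :=
    (tendsto_pow_atTop_nhds_zero_of_lt_one (by norm_num) (by norm_num)).mul_const _
  rw [zero_mul] at ht
  obtain ⟨n, hn⟩ := (ht.eventually (gt_mem_nhds hε)).exists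
  obtain ⟨y, hy, hxy⟩ := key n x hx
  exact ⟨y, hy, hxy.trans_lt hn⟩

theorem eq_gasket (p : Fin 3 → Plane) {K : Set Plane} (hK : IsCompact K) (hK' : K.Nonempty)
    (hKL : K = ⋃ i, L p i '' K) : K = gasket p :=
  Subset.antisymm
    (subset_of_eq_iUnion p hK (isCompact_gasket p) (gasket_nonempty p) hKL (gasket_eq_iUnion p))
    (subset_of_eq_iUnion p (isCompact_gasket p) hK hK' (gasket_eq_iUnion p) hKL)

/-- The supremum norm `‖g‖_∞` of a continuous function on the gasket. -/
def supNorm (p : Fin 3 → Plane) (g : Plane → ℝ) : ℝ := sSup ((fun t => |g t|) '' gasket p)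

/-- `α_max`, the largest of the norms `‖α_ω‖_∞`, `ω ∈ {1,2,3}^N`. -/
def scalingMax (p : Fin 3 → Plane) {N : ℕ} (α : (Fin N → Fin 3) → Plane → ℝ) : ℝ :=
  ⨆ ω, supNorm p (α ω)

/-- `α_min`, the smallest of the norms `‖α_ω‖_∞`, `ω ∈ {1,2,3}^N`. -/
def scalingMin (p : Fin 3 → Plane) {N : ℕ} (α : (Fin N → Fin 3) → Plane → ℝ) : ℝ :=
  ⨅ ω, supNorm p (α ω)

/-- `γ`, the sum of the norms `‖α_ω‖_∞`, `ω ∈ {1,2,3}^N`. -/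
def scalingSum (p : Fin 3 → Plane) {N : ℕ} (α : (Fin N → Fin 3) → Plane → ℝ) : ℝ :=
  ∑ ω, supNorm p (α ω)

/-- `g` is the `α`-fractal function of `f` with base function `b` and scaling functions `α_ω`: the
continuous function on the gasket with the self-referential equation
`g(t) = f(t) + α_ω(L_ω⁻¹ t) g(L_ω⁻¹ t) - α_ω(L_ω⁻¹ t) b(L_ω⁻¹ t)` for all `t ∈ L_ω(SG)` and all
words `ω` of length `N` (written here with `t = L_ω(s)`, `s ∈ SG`). Functions on the gasket
are represented by functions on the plane of which only the values on the gasket are used. -/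
structure IsAlphaFractalFunction (p : Fin 3 → Plane) {N : ℕ} (f b : Plane → ℝ)
    (α : (Fin N → Fin 3) → Plane → ℝ) (g : Plane → ℝ) : Prop where
  continuousOn : ContinuousOn g (gasket p)
  self_referential : ∀ ω : Fin N → Fin 3, ∀ s ∈ gasket p,
    g (wordMap p ω s) = f (wordMap p ω s) + α ω s * g s - α ω s * b s

/-- The graph `{(t, g(t)) : t ∈ SG}` as a subset of Euclidean space `ℝ³`. -/
def graph (p : Fin 3 → Plane) (g : Plane → ℝ) : Set (EuclideanSpace ℝ (Fin 3)) :=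
  (fun t : Plane => !₂[t 0, t 1, g t]) '' gasket p

end SG

namespace BoxDim

/-- The cube `∏ i, [m_i δ, (m_i + 1) δ]` of the `δ`-mesh of `ℝ^d`. -/
def meshCube {d : ℕ} (δ : ℝ) (m : Fin d → ℤ) : Set (EuclideanSpace ℝ (Fin d)) :=
  {x | ∀ i, x i ∈ Icc ((m i : ℝ) * δ) (((m i : ℝ) + 1) * δ)}

/-- `N_δ(A)`, the number of cubes of the `δ`-mesh that intersect the bounded set `A`. -/
def cubeCount {d : ℕ} (A : Set (EuclideanSpace ℝ (Fin d))) (δ : ℝ) : ℕ :=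
  {m : Fin d → ℤ | (meshCube δ m ∩ A).Nonempty}.ncard

/-- Lower box dimension of a nonempty bounded set. -/
def lowerBoxDim {d : ℕ} (A : Set (EuclideanSpace ℝ (Fin d))) : EReal :=
  liminf (fun δ : ℝ => ((Real.log (cubeCount A δ) / (-Real.log δ) : ℝ) : EReal)) (𝓝[>] 0)

/-- Upper box dimension of a nonempty bounded set. -/
def upperBoxDim {d : ℕ} (A : Set (EuclideanSpace ℝ (Fin d))) : EReal :=
  limsup (fun δ : ℝ => ((Real.log (cubeCount A δ) / (-Real.log δ) : ℝ) : EReal)) (𝓝[>] 0)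

end BoxDim

end

/-! Lower bound: projecting the graph to the plane is Lipschitz and has image the gasket, so only
the gasket matters. In affine coordinates, a point with address `w` becomes the pair of binary
numbers with digits `[w k = 1]` and `[w k = 2]`. A set of diameter at most `2⁻ⁿ` meets boundedly
many level-`n` cylinders, each of mass `3⁻ⁿ` for the uniform Bernoulli measure, and the mass
distribution principle gives `log 3 / log 2` (`log_three_div_log_two_le_dimH_range`).

Upper bound: put `r = 2⁻ᴺ` and `θ = r ^ σ`. By self-reference, the oscillation of `g` on `L_ω(S)`,
for a level-`n` cell `S`, is at most `‖α_ω‖` times that on `S` plus `E θⁿ`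
(`exists_abs_sub_wordMap_le`). Summed over cells this reads `Tₙ₊₁ ≤ β Tₙ + 3ᴺ E (3ᴺ θ)ⁿ` for any `β`
at least the sum of the norms, hence `Tₙ ≤ M βⁿ` once `3ᴺ θ < β` (`exists_cells`). At scale about
`rⁿ` the graph meets at most a constant times `(β / r)ⁿ + 3ᴺⁿ` cubes, and `3ᴺ ≤ β / r` because `σ ≤
1`. This yields `1 + log β / (N log 2)`. The two parts take `β = γ̃` and `β = 3ᴺ α_max`. -/

/-! ### Lower bound for the Hausdorff dimension. -/

section GasketDimension

open MeasureTheory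
open scoped ENNReal

/-- The mass distribution principle for the image of a probability measure. -/
theorem le_dimH_range_of_measure_preimage_le {Ω X : Type*} [MeasurableSpace Ω] [EMetricSpace X]
    [MeasurableSpace X] [BorelSpace X] (μ : Measure Ω) [IsProbabilityMeasure μ] {c : Ω → X}
    (hc : Measurable c) {d C : ℝ≥0}
    (h : ∀ s : Set X, IsClosed s → Metric.ediam s ≤ 1 →
      μ (c ⁻¹' s) ≤ C * Metric.ediam s ^ (d : ℝ)) :
    (d : ℝ≥0∞) ≤ dimH (range c) := by
  -- `C + 1` replaces `C` so that the constant can be inverted even when `C = 0`. Closures enter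
  -- below because `s` is arbitrary: they are measurable and have the same diameter.
  have hC : (C : ℝ≥0∞) + 1 ≠ 0 := by simp
  have hC' : (C : ℝ≥0∞) + 1 ≠ ⊤ := by simp
  have key : ((C : ℝ≥0∞) + 1)⁻¹ • μ.map c ≤ μH[(d : ℝ)] := by
    refine Measure.le_hausdorffMeasure _ _ 1 one_pos fun s hs => ?_
    rw [Measure.smul_apply, smul_eq_mul]
    calc ((C : ℝ≥0∞) + 1)⁻¹ * μ.map c s
        ≤ ((C : ℝ≥0∞) + 1)⁻¹ * μ.map c (closure s) := by gcongr; exact subset_closure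
      _ ≤ ((C : ℝ≥0∞) + 1)⁻¹ * (((C : ℝ≥0∞) + 1) * Metric.ediam s ^ (d : ℝ)) := by
          gcongr
          rw [Measure.map_apply hc isClosed_closure.measurableSet]
          refine (h _ isClosed_closure (by rwa [Metric.ediam_closure])).trans ?_
          rw [Metric.ediam_closure]
          gcongr
          exact le_self_add
      _ = Metric.ediam s ^ (d : ℝ) := by
          rw [← mul_assoc, ENNReal.inv_mul_cancel hC hC', one_mul]
  refine le_dimH_of_hausdorffMeasure_ne_zero fun h0 => ?_
  have h1 := key (range c)
  rw [h0, nonpos_iff_eq_zero, Measure.smul_apply, smul_eq_mul, mul_eq_zero] at h1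
  rcases h1 with h1 | h1
  · exact hC' (ENNReal.inv_eq_zero.1 h1)
  · have h2 := Measure.le_map_apply (μ := μ) hc.aemeasurable (range c)
    rw [preimage_range, measure_univ, h1] at h2
    simp at h2

namespace SG

/-- The number with the binary digits `[w 0 = j], [w 1 = j], …` after the point. -/
noncomputable def binaryCoord (j : Fin 3) (w : ℕ → Fin 3) : ℝ :=
  ∑' k : ℕ, (1 / 2 : ℝ) ^ (k + 1) * (if w k = j then 1 else 0)

/-- The integer with the binary digits `[w 0 = j], …, [w (n - 1) = j]`. -/
def binaryPrefix (j : Fin 3) (w : ℕ → Fin 3) : ℕ → ℕ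
  | 0 => 0
  | n + 1 => 2 * binaryPrefix j w n + if w n = j then 1 else 0

theorem hasSum_half_pow : HasSum (fun k : ℕ => (1 / 2 : ℝ) ^ (k + 1)) 1 := by
  simpa [pow_succ] using (hasSum_geometric_two).mul_right (1 / 2 : ℝ)

theorem summable_binaryCoord (j : Fin 3) (w : ℕ → Fin 3) :
    Summable fun k : ℕ => (1 / 2 : ℝ) ^ (k + 1) * (if w k = j then (1 : ℝ) else 0) :=
  hasSum_half_pow.summable.of_nonneg_of_le (fun k => by positivity)
    (fun k => mul_le_of_le_one_right (by positivity) (by split_ifs <;> norm_num))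

theorem binaryCoord_nonneg (j : Fin 3) (w : ℕ → Fin 3) : 0 ≤ binaryCoord j w :=
  tsum_nonneg fun k => by positivity

theorem binaryCoord_le_one (j : Fin 3) (w : ℕ → Fin 3) : binaryCoord j w ≤ 1 := by
  rw [← hasSum_half_pow.tsum_eq]
  exact (summable_binaryCoord j w).tsum_le_tsum
    (fun k => mul_le_of_le_one_right (by positivity) (by split_ifs <;> norm_num))
    hasSum_half_pow.summable

theorem binaryCoord_eq (j : Fin 3) (w : ℕ → Fin 3) :
    2 * binaryCoord j w = (if w 0 = j then 1 else 0) + binaryCoord j fun k => w (k + 1) := by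
  unfold binaryCoord
  rw [(summable_binaryCoord j w).tsum_eq_zero_add, mul_add, ← tsum_mul_left]
  congr 1
  · norm_num
  · refine tsum_congr fun k => ?_
    ring

/-- Multiplication by `2 ^ n` moves the binary point past the first `n` digits. -/
theorem two_pow_mul_binaryCoord (j : Fin 3) (w : ℕ → Fin 3) (n : ℕ) :
    2 ^ n * binaryCoord j w = binaryPrefix j w n + binaryCoord j fun k => w (k + n) := by
  induction n with
  | zero => simp [binaryPrefix]
  | succ n ih =>
    have h := binaryCoord_eq j fun k => w (k + n)
    rw [pow_succ, mul_right_comm, ih, add_mul, mul_comm (binaryCoord _ _), h, binaryPrefix]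
    simp only [zero_add, add_right_comm _ 1 n, add_assoc]
    push_cast
    ring

theorem continuous_binaryCoord (j : Fin 3) : Continuous (binaryCoord j) := by
  refine continuous_tsum (fun k => ?_) hasSum_half_pow.summable fun k w => ?_
  · have h : Continuous fun w : ℕ → Fin 3 => (if w k = j then (1 : ℝ) else 0) :=
      Continuous.comp (g := fun i : Fin 3 => if i = j then (1 : ℝ) else 0)
        continuous_of_discreteTopology (continuous_apply k)
    exact h.const_mul _
  · rw [Real.norm_of_nonneg (by positivity)]
    exact mul_le_of_le_one_right (by positivity) (by split_ifs <;> norm_num)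

/-- Parity recovers the last digit of each prefix, and the digits for `1` and `2` together determine
the letter, both being zero exactly for the letter `0`. -/
theorem eq_of_binaryPrefix_eq {w w' : ℕ → Fin 3} {n : ℕ}
    (h1 : binaryPrefix 1 w n = binaryPrefix 1 w' n)
    (h2 : binaryPrefix 2 w n = binaryPrefix 2 w' n) : ∀ k < n, w k = w' k := by
  induction n with
  | zero => simp
  | succ n ih =>
    simp only [binaryPrefix] at h1 h2
    have e1 : binaryPrefix 1 w n = binaryPrefix 1 w' n := by split_ifs at h1 <;> omega
    have e2 : binaryPrefix 2 w n = binaryPrefix 2 w' n := by split_ifs at h2 <;> omega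
    intro k hk
    rcases Nat.lt_succ_iff_lt_or_eq.1 hk with hk | rfl
    · exact ih e1 e2 k hk
    · rw [e1] at h1
      rw [e2] at h2
      generalize w k = a at *
      generalize w' k = a' at *
      fin_cases a <;> fin_cases a' <;> simp_all

/-- The uniform Bernoulli measure on the space of addresses. -/
noncomputable def addressMeasure : Measure (ℕ → Fin 3) :=
  Measure.infinitePi fun _ : ℕ => (PMF.uniformOfFintype (Fin 3)).toMeasure

instance : IsProbabilityMeasure addressMeasure := by
  unfold addressMeasure
  infer_instance

theorem addressMeasure_cylinder (w : ℕ → Fin 3) (n : ℕ) :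
    addressMeasure {w' | ∀ k < n, w' k = w k} = (3 : ℝ≥0∞)⁻¹ ^ n := by
  have h : {w' : ℕ → Fin 3 | ∀ k < n, w' k = w k} =
      Set.pi (Finset.range n : Set ℕ) fun k => {w k} := by
    ext w'
    simp [Set.mem_pi]
  rw [h, addressMeasure, Measure.infinitePi_pi _ (by simp)]
  simp

theorem addressMeasure_binaryPrefix_le (n x y : ℕ) :
    addressMeasure {w | binaryPrefix 1 w n = x ∧ binaryPrefix 2 w n = y} ≤ (3 : ℝ≥0∞)⁻¹ ^ n := by
  rcases eq_empty_or_nonempty {w | binaryPrefix 1 w n = x ∧ binaryPrefix 2 w n = y} with h | ⟨w, hw⟩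
  · simp [h]
  · rw [← addressMeasure_cylinder w n]
    refine measure_mono fun w' hw' => ?_
    exact eq_of_binaryPrefix_eq (hw'.1.trans hw.1.symm) (hw'.2.trans hw.2.symm)

/-- After scaling by `2 ^ n` the coordinates differ by at most `1`, and the tails, both in `[0, 1]`,
add at most `1` more. -/
theorem binaryPrefix_mem_Icc {j : Fin 3} {w w' : ℕ → Fin 3} {n : ℕ}
    (h : dist (binaryCoord j w) (binaryCoord j w') ≤ (1 / 2 : ℝ) ^ n) :
    binaryPrefix j w' n ∈ Finset.Icc (binaryPrefix j w n - 2) (binaryPrefix j w n + 2) := by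
  have e := two_pow_mul_binaryCoord j w n
  have e' := two_pow_mul_binaryCoord j w' n
  have a0 := binaryCoord_nonneg j fun k => w (k + n)
  have a1 := binaryCoord_le_one j fun k => w (k + n)
  have b0 := binaryCoord_nonneg j fun k => w' (k + n)
  have b1 := binaryCoord_le_one j fun k => w' (k + n)
  have hp : (2 : ℝ) ^ n * (1 / 2) ^ n = 1 := by rw [← mul_pow]; norm_num
  rw [Real.dist_eq] at h
  have h' : |(2 : ℝ) ^ n * binaryCoord j w - 2 ^ n * binaryCoord j w'| ≤ 1 := by
    rw [← mul_sub, abs_mul, abs_of_pos (by positivity), ← hp]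
    gcongr
  rw [abs_le] at h'
  have c1 : (binaryPrefix j w' n : ℝ) ≤ binaryPrefix j w n + 2 := by linarith
  have c2 : (binaryPrefix j w n : ℝ) ≤ binaryPrefix j w' n + 2 := by linarith
  rw [Finset.mem_Icc]
  norm_cast at c1 c2
  omega

theorem addressMeasure_preimage_le {s : Set (ℝ × ℝ)} {n : ℕ}
    (h : Metric.ediam s ≤ ENNReal.ofReal ((1 / 2 : ℝ) ^ n)) :
    addressMeasure ((fun w => (binaryCoord 1 w, binaryCoord 2 w)) ⁻¹' s) ≤
      25 * (3 : ℝ≥0∞)⁻¹ ^ n := by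
  rcases eq_empty_or_nonempty ((fun w => (binaryCoord 1 w, binaryCoord 2 w)) ⁻¹' s) with
    h0 | ⟨w, hw⟩
  · simp [h0]
  set I : Fin 3 → Finset ℕ := fun j =>
    Finset.Icc (binaryPrefix j w n - 2) (binaryPrefix j w n + 2)
  have hI : ∀ j, (I j).card ≤ 5 := fun j => by simp only [I, Nat.card_Icc]; omega
  have hsub : (fun w => (binaryCoord 1 w, binaryCoord 2 w)) ⁻¹' s ⊆
      ⋃ x ∈ I 1 ×ˢ I 2, {w | binaryPrefix 1 w n = x.1 ∧ binaryPrefix 2 w n = x.2} := by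
    intro w' hw'
    have hd := (Metric.edist_le_ediam_of_mem (mem_preimage.1 hw) (mem_preimage.1 hw')).trans h
    rw [edist_le_ofReal (by positivity), Prod.dist_eq, max_le_iff] at hd
    simp only [mem_iUnion]
    exact ⟨(binaryPrefix 1 w' n, binaryPrefix 2 w' n), Finset.mem_product.2
      ⟨binaryPrefix_mem_Icc hd.1, binaryPrefix_mem_Icc hd.2⟩, rfl, rfl⟩
  calc _ ≤ _ := measure_mono hsub
    _ ≤ _ := measure_biUnion_finset_le _ _
    _ ≤ ∑ _x ∈ I 1 ×ˢ I 2, (3 : ℝ≥0∞)⁻¹ ^ n :=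
        Finset.sum_le_sum fun x _ => addressMeasure_binaryPrefix_le n x.1 x.2
    _ = ((I 1).card * (I 2).card : ℕ) * (3 : ℝ≥0∞)⁻¹ ^ n := by
        rw [Finset.sum_const, Finset.card_product, nsmul_eq_mul]
    _ ≤ (5 * 5 : ℕ) * (3 : ℝ≥0∞)⁻¹ ^ n := by
        gcongr
        exacts [hI 1, hI 2]
    _ = 25 * (3 : ℝ≥0∞)⁻¹ ^ n := by norm_num

theorem half_pow_rpow_log_three_div_log_two (n : ℕ) :
    ((1 / 2 : ℝ) ^ n) ^ (Real.log 3 / Real.log 2) = (1 / 3 : ℝ) ^ n := by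
  have h2 : Real.log 2 ≠ 0 := (Real.log_pos (by norm_num)).ne'
  rw [← Real.rpow_natCast, ← Real.rpow_mul (by norm_num), mul_comm, Real.rpow_mul (by norm_num),
    Real.rpow_natCast]
  congr 1
  rw [one_div, Real.inv_rpow (by norm_num), Real.rpow_def_of_pos (by norm_num),
    mul_div_cancel₀ _ h2, Real.exp_log (by norm_num), one_div]

theorem log_three_div_log_two_le_dimH_range :
    ENNReal.ofReal (Real.log 3 / Real.log 2) ≤
      dimH (range fun w => (binaryCoord 1 w, binaryCoord 2 w)) := by
  have hd : 0 < Real.log 3 / Real.log 2 :=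
    div_pos (Real.log_pos (by norm_num)) (Real.log_pos (by norm_num))
  have hc : Continuous fun w => (binaryCoord 1 w, binaryCoord 2 w) :=
    (continuous_binaryCoord 1).prodMk (continuous_binaryCoord 2)
  -- `75 = 25 * 3`: there are at most `5 * 5` prefix pairs, and a factor `3` is lost between `(1 /
  -- 3) ^ n` and `(1 / 3) ^ (n + 1)` when the diameter is rounded to a power of `1 / 2`. Diameter
  -- zero is handled by letting `n → ∞`.
  refine le_dimH_range_of_measure_preimage_le addressMeasure hc.measurable (C := 75)
    fun s _ hs1 => ?_
  rw [Real.coe_toNNReal _ hd.le]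
  have htop : Metric.ediam s ≠ ⊤ := (hs1.trans_lt ENNReal.one_lt_top).ne
  obtain ⟨r, hr⟩ : ∃ r : ℝ≥0, Metric.ediam s = r := ⟨_, (ENNReal.coe_toNNReal htop).symm⟩
  have e3 : ∀ n : ℕ, (3 : ℝ≥0∞)⁻¹ ^ n = ENNReal.ofReal ((1 / 3 : ℝ) ^ n) := fun n => by
    rw [ENNReal.ofReal_pow (by norm_num), one_div, ENNReal.ofReal_inv_of_pos (by norm_num)]
    norm_num
  rcases eq_or_ne r 0 with h0 | h0
  · have ht : Tendsto (fun n : ℕ => 25 * (3 : ℝ≥0∞)⁻¹ ^ n) atTop (𝓝 (25 * 0)) :=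
      ENNReal.Tendsto.const_mul
        (ENNReal.tendsto_pow_atTop_nhds_zero_of_lt_one (by simp)) (by simp)
    rw [mul_zero] at ht
    refine (ge_of_tendsto' ht fun n => addressMeasure_preimage_le ?_).trans zero_le
    simp [hr, h0]
  · have hr1 : (r : ℝ) ≤ 1 := by
      rw [hr] at hs1
      exact_mod_cast hs1
    have hr0 : (0 : ℝ) < r := by positivity
    obtain ⟨n, hn, hn'⟩ := exists_nat_pow_near_of_lt_one hr0 hr1
      (by norm_num : (0 : ℝ) < 1 / 2) (by norm_num)
    have hle : (1 / 3 : ℝ) ^ (n + 1) ≤ (r : ℝ) ^ (Real.log 3 / Real.log 2) := by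
      rw [← half_pow_rpow_log_three_div_log_two]
      exact Real.rpow_le_rpow (by positivity) hn.le hd.le
    have hrn : Metric.ediam s ≤ ENNReal.ofReal ((1 / 2 : ℝ) ^ n) := by
      rw [hr, ← ENNReal.ofReal_coe_nnreal]
      exact ENNReal.ofReal_le_ofReal hn'
    refine (addressMeasure_preimage_le hrn).trans ?_
    rw [hr, ← ENNReal.ofReal_coe_nnreal, ← ENNReal.ofReal_coe_nnreal,
      ENNReal.ofReal_rpow_of_pos hr0, ← ENNReal.ofReal_mul (by simp), e3,
      show (25 : ℝ≥0∞) = ENNReal.ofReal 25 by norm_num, ← ENNReal.ofReal_mul (by norm_num)]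
    refine ENNReal.ofReal_le_ofReal ?_
    rw [pow_succ] at hle
    push_cast
    linarith

theorem exists_affine_coordinates {p : Fin 3 → Plane} (hp : IsEquilateral p) :
    ∃ l₁ l₂ : Plane →L[ℝ] ℝ, (∀ i, l₁ (p i) = l₁ (p 0) + if i = 1 then 1 else 0) ∧
      ∀ i, l₂ (p i) = l₂ (p 0) + if i = 2 then 1 else 0 := by
  obtain ⟨s, hs, hd⟩ := hp
  set u := p 1 - p 0
  set v := p 2 - p 0
  have hu : ‖u‖ = s := by rw [← dist_eq_norm, hd _ _ (by decide)]
  have hv : ‖v‖ = s := by rw [← dist_eq_norm, hd _ _ (by decide)]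
  have huv : inner ℝ u v = s ^ 2 / 2 := by
    have h1 : inner ℝ (u - v) (u - v) = s ^ 2 := by
      rw [real_inner_self_eq_norm_sq, sub_sub_sub_cancel_right, ← dist_eq_norm,
        hd _ _ (by decide)]
    rw [real_inner_sub_sub_self, real_inner_self_eq_norm_sq, real_inner_self_eq_norm_sq, hu,
      hv] at h1
    linarith
  have hvu : inner ℝ v u = s ^ 2 / 2 := by rw [real_inner_comm, huv]
  have e : ∀ (l : Plane →L[ℝ] ℝ) (a : Fin 3 → ℝ), a 0 = 0 → l u = a 1 → l v = a 2 →
      ∀ i, l (p i) = l (p 0) + a i := by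
    intro l a h0 h1 h2 i
    rw [map_sub] at h1 h2
    fin_cases i
    · simp [h0]
    · change l (p 1) = _ + a 1
      linarith
    · change l (p 2) = _ + a 2
      linarith
  have hs' : s ≠ 0 := hs.ne'
  -- This is the dual basis of `u, v`: since `⟪u, v⟫ = s² / 2`, the vector `2u - v` is orthogonal to
  -- `v` and has inner product `3s² / 2` with `u`.
  refine ⟨(2 / (3 * s ^ 2)) • innerSL ℝ ((2 : ℝ) • u - v),
    (2 / (3 * s ^ 2)) • innerSL ℝ ((2 : ℝ) • v - u), e _ _ ?_ ?_ ?_, e _ _ ?_ ?_ ?_⟩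
  · rfl
  · simp [hu, hvu]
    field_simp
    ring
  · simp [hv, huv]
    field_simp
    ring_nf
    simp
  · rfl
  · simp [hu, hvu]
    field_simp
    ring_nf
    simp
  · simp [hv, huv]
    field_simp
    ring

/-- The weights `(1 / 2) ^ (k + 1)` sum to `1`, so the common offset `l (p 0)` comes out once. -/
theorem apply_point {p : Fin 3 → Plane} {l : Plane →L[ℝ] ℝ} {j : Fin 3}
    (hl : ∀ i, l (p i) = l (p 0) + if i = j then 1 else 0) (w : ℕ → Fin 3) :
    l (point p w) = l (p 0) + binaryCoord j w := by
  have h1 := (summable_term p w).hasSum.mapL l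
  have h2 := (hasSum_half_pow.mul_right (l (p 0))).add (summable_binaryCoord j w).hasSum
  rw [one_mul] at h2
  refine h1.unique (h2.congr_fun ?_)
  intro k
  simp only [map_smul, smul_eq_mul, hl (w k)]
  ring

theorem log_three_div_log_two_le_dimH_graph {p : Fin 3 → Plane} (hp : IsEquilateral p)
    (g : Plane → ℝ) : ENNReal.ofReal (Real.log 3 / Real.log 2) ≤ dimH (graph p g) := by
  obtain ⟨l₁, l₂, h₁, h₂⟩ := exists_affine_coordinates hp
  set π : EuclideanSpace ℝ (Fin 3) →L[ℝ] Plane :=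
    LinearMap.toContinuousLinearMap
      { toFun := fun x => !₂[x 0, x 1]
        map_add' := fun x y => by ext i; fin_cases i <;> simp
        map_smul' := fun c x => by ext i; fin_cases i <;> simp }
  have hπ : ∀ t : Plane, π !₂[t 0, t 1, g t] = t := fun t => by
    ext i
    fin_cases i <;> simp [π]
  set φ : EuclideanSpace ℝ (Fin 3) → ℝ × ℝ :=
    fun x => ((l₁.prod l₂).comp π) x - (l₁ (p 0), l₂ (p 0))
  have hφ : LipschitzWith _ φ := ((l₁.prod l₂).comp π).lipschitz.sub (LipschitzWith.const _)
  refine log_three_div_log_two_le_dimH_range.trans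
    ((dimH_mono ?_).trans (hφ.dimH_image_le (graph p g)))
  rintro _ ⟨w, rfl⟩
  refine ⟨_, ⟨point p w, ⟨w, rfl⟩, rfl⟩, ?_⟩
  simp only [φ, ContinuousLinearMap.comp_apply, hπ, ContinuousLinearMap.prod_apply,
    apply_point h₁, apply_point h₂]
  simp

end SG

end GasketDimension

/-! ### Mesh cubes and box dimensions. -/

namespace BoxDim

open MeasureTheory
open scoped ENNReal

variable {d : ℕ}

/-- The cubes are closed, so one that only touches `lo i` with its upper face counts; hence the `-
1`. -/
theorem mem_piFinset_of_meshCube_inter_nonempty {A : Set (EuclideanSpace ℝ (Fin d))} {δ : ℝ}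
    (hδ : 0 < δ) {lo hi : Fin d → ℝ} (hA : ∀ x ∈ A, ∀ i, x i ∈ Icc (lo i) (hi i))
    {m : Fin d → ℤ} (hm : (meshCube δ m ∩ A).Nonempty) :
    m ∈ Fintype.piFinset fun i => Finset.Icc (⌈lo i / δ⌉ - 1) ⌊hi i / δ⌋ := by
  obtain ⟨x, hx, hxA⟩ := hm
  refine Fintype.mem_piFinset.2 fun i => Finset.mem_Icc.2 ⟨?_, ?_⟩
  · rw [sub_le_iff_le_add, Int.ceil_le, div_le_iff₀ hδ]
    push_cast
    exact (hA x hxA i).1.trans (hx i).2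
  · rw [Int.le_floor, le_div_iff₀ hδ]
    exact (hx i).1.trans (hA x hxA i).2

theorem card_Icc_ceil_floor_le {lo hi δ : ℝ} (hδ : 0 < δ) (h : lo ≤ hi) :
    ((Finset.Icc (⌈lo / δ⌉ - 1) ⌊hi / δ⌋).card : ℝ) ≤ (hi - lo) / δ + 2 := by
  have h1 : lo / δ ≤ hi / δ := by gcongr
  have h2 := Int.le_ceil (lo / δ)
  have h3 := Int.floor_le (hi / δ)
  rw [Int.card_Icc, ← Int.cast_natCast, Int.toNat_eq_max, Int.cast_max, sub_div]
  push_cast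
  exact max_le (by linarith) (by linarith)

theorem finite_meshCube_inter_nonempty {A : Set (EuclideanSpace ℝ (Fin d))}
    (hA : Bornology.IsBounded A) {δ : ℝ} (hδ : 0 < δ) :
    {m : Fin d → ℤ | (meshCube δ m ∩ A).Nonempty}.Finite := by
  obtain ⟨R, hR⟩ := hA.exists_norm_le
  refine (Finset.finite_toSet (Fintype.piFinset fun i =>
    Finset.Icc (⌈(fun _ => -R : Fin d → ℝ) i / δ⌉ - 1) ⌊(fun _ => R : Fin d → ℝ) i / δ⌋)).subset
    fun m hm => ?_
  refine mem_piFinset_of_meshCube_inter_nonempty hδ (fun x hx i => ?_) hm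
  exact abs_le.1 ((PiLp.norm_apply_le x i).trans (hR x hx))

theorem exists_mem_meshCube {δ : ℝ} (hδ : 0 < δ) (x : EuclideanSpace ℝ (Fin d)) :
    ∃ m : Fin d → ℤ, x ∈ meshCube δ m := by
  refine ⟨fun i => ⌊x i / δ⌋, fun i => ⟨?_, ?_⟩⟩
  · exact (le_div_iff₀ hδ).1 (Int.floor_le _)
  · exact ((div_lt_iff₀ hδ).1 (Int.lt_floor_add_one _)).le

theorem one_le_cubeCount {A : Set (EuclideanSpace ℝ (Fin d))} (hA : Bornology.IsBounded A)
    (hA' : A.Nonempty) {δ : ℝ} (hδ : 0 < δ) : 1 ≤ cubeCount A δ := by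
  obtain ⟨x, hx⟩ := hA'
  obtain ⟨m, hm⟩ := exists_mem_meshCube hδ x
  exact (Set.ncard_pos (finite_meshCube_inter_nonempty hA hδ)).2 ⟨m, x, hm, hx⟩

theorem ediam_meshCube_le {δ : ℝ} (hδ : 0 ≤ δ) (m : Fin d → ℤ) :
    Metric.ediam (meshCube δ m) ≤ ENNReal.ofReal (√d * δ) := by
  refine Metric.ediam_le fun x hx y hy => ?_
  rw [edist_le_ofReal (by positivity), EuclideanSpace.dist_eq]
  refine Real.sqrt_le_iff.2 ⟨by positivity, ?_⟩
  calc ∑ i, dist (x i) (y i) ^ 2 ≤ ∑ _i : Fin d, δ ^ 2 := by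
        refine Finset.sum_le_sum fun i _ => ?_
        gcongr
        refine (Real.dist_le_of_mem_Icc (hx i) (hy i)).trans (le_of_eq (by ring))
    _ = (√d * δ) ^ 2 := by
        rw [mul_pow, Real.sq_sqrt (Nat.cast_nonneg d)]
        simp

theorem cubeCount_mul_rpow_le {A : Set (EuclideanSpace ℝ (Fin d))} {δ s : ℝ}
    (hδ : 0 < δ) (hδ1 : δ < 1) (hN : 1 ≤ cubeCount A δ)
    (h : Real.log (cubeCount A δ) / (-Real.log δ) < s) :
    (cubeCount A δ : ℝ) * δ ^ s ≤ 1 := by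
  have hl : 0 < -Real.log δ := neg_pos.2 (Real.log_neg hδ hδ1)
  rw [div_lt_iff₀ hl] at h
  have hN' : (0 : ℝ) < cubeCount A δ := by exact_mod_cast hN
  rw [Real.rpow_def_of_pos hδ, ← Real.exp_log hN', ← Real.exp_add, Real.exp_le_one_iff]
  linarith

/-- The Hausdorff dimension is at most the lower box dimension. -/
theorem dimH_le_lowerBoxDim {A : Set (EuclideanSpace ℝ (Fin d))} (hA : Bornology.IsBounded A)
    (hA' : A.Nonempty) : (dimH A : EReal) ≤ lowerBoxDim A := by
  classical
  -- For `s` strictly between the two dimensions, arbitrarily small `δ` satisfy `N_δ δ ^ s ≤ 1`. The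
  -- mesh cubes at these scales bound `μH[s] A` by `√d ^ s`, whereas `s < dimH A` makes it infinite.
  by_contra! hlt
  obtain ⟨s, hs1, hs2⟩ := EReal.lt_iff_exists_real_btwn.1 hlt
  have hfreq : ∃ᶠ δ in 𝓝[>] (0 : ℝ), Real.log (cubeCount A δ) / (-Real.log δ) < s :=
    (frequently_lt_of_liminf_lt (by isBoundedDefault) hs1).mono fun δ h => EReal.coe_lt_coe_iff.1 h
  have hev : ∀ᶠ δ in 𝓝[>] (0 : ℝ), δ ∈ Ioo (0 : ℝ) 1 := Ioo_mem_nhdsGT one_pos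
  set S : Set ℝ := {δ | Real.log (cubeCount A δ) / (-Real.log δ) < s ∧ δ ∈ Ioo (0 : ℝ) 1}
  have hS : ∃ᶠ δ in 𝓝[>] (0 : ℝ), δ ∈ S := hfreq.and_eventually hev
  have hs0 : 0 < s := by
    obtain ⟨δ, h, h0, h1⟩ := hS.exists
    refine lt_of_le_of_lt (div_nonneg (Real.log_natCast_nonneg _) ?_) h
    exact neg_nonneg.2 (Real.log_neg h0 h1).le
  -- Restricting to the good scales turns "frequently" into "eventually".
  set l : Filter ℝ := 𝓝[>] 0 ⊓ 𝓟 S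
  have : l.NeBot := frequently_mem_iff_neBot.1 hS
  have hl : ∀ᶠ δ in l, δ ∈ S := mem_inf_of_right (mem_principal_self S)
  have hl0 : Tendsto (fun δ : ℝ => ENNReal.ofReal (√d * δ)) l (𝓝 0) := by
    have h1 : Tendsto (fun δ : ℝ => √d * δ) (𝓝 0) (𝓝 (√d * 0)) :=
      (continuous_const_mul _).tendsto 0
    rw [mul_zero] at h1
    have h2 := ENNReal.tendsto_ofReal h1
    rw [ENNReal.ofReal_zero] at h2
    exact h2.mono_left (inf_le_left.trans nhdsWithin_le_nhds)
  set F : ℝ → Finset (Fin d → ℤ) := fun δ =>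
    if h : {m : Fin d → ℤ | (meshCube δ m ∩ A).Nonempty}.Finite then h.toFinset else ∅
  have hF : ∀ δ (hδ : 0 < δ), F δ = (finite_meshCube_inter_nonempty hA hδ).toFinset :=
    fun δ hδ => dif_pos _
  have hle := Measure.hausdorffMeasure_le_liminf_sum (ι := fun δ => F δ) s A
    (fun δ : ℝ => ENNReal.ofReal (√d * δ)) hl0 (fun δ m => meshCube δ m.1)
    (hl.mono fun δ hδ m => ediam_meshCube_le hδ.2.1.le m.1)
    (hl.mono fun δ hδ x hx => by
      obtain ⟨m, hm⟩ := exists_mem_meshCube hδ.2.1 x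
      exact mem_iUnion.2 ⟨⟨m, by rw [hF δ hδ.2.1, Set.Finite.mem_toFinset]; exact ⟨x, hm, hx⟩⟩, hm⟩)
  have hbound : liminf (fun δ => ∑ m : F δ, Metric.ediam (meshCube δ m.1) ^ s) l ≤
      ENNReal.ofReal (√d ^ s) := by
    refine (liminf_le_liminf (v := fun _ => ENNReal.ofReal (√d ^ s)) ?_).trans
      (liminf_const _).le
    refine hl.mono fun δ hδ => ?_
    have hδ0 := hδ.2.1
    calc ∑ m : F δ, Metric.ediam (meshCube δ m.1) ^ s
        ≤ ∑ _m : F δ, ENNReal.ofReal (√d * δ) ^ s := by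
          refine Finset.sum_le_sum fun m _ => ?_
          exact ENNReal.rpow_le_rpow (ediam_meshCube_le hδ0.le m.1) hs0.le
      _ = ENNReal.ofReal (cubeCount A δ * (√d * δ) ^ s) := by
          rw [ENNReal.ofReal_mul (Nat.cast_nonneg _), ENNReal.ofReal_natCast,
            ENNReal.ofReal_rpow_of_nonneg (by positivity) hs0.le, Finset.sum_const,
            Finset.card_univ, Fintype.card_coe, hF δ hδ0, nsmul_eq_mul, cubeCount,
            Set.ncard_eq_toFinset_card _ (finite_meshCube_inter_nonempty hA hδ0)]
      _ ≤ ENNReal.ofReal (√d ^ s) := by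
          refine ENNReal.ofReal_le_ofReal ?_
          rw [Real.mul_rpow (by positivity) hδ0.le, mul_left_comm]
          exact mul_le_of_le_one_right (by positivity)
            (cubeCount_mul_rpow_le hδ0 hδ.2.2 (one_le_cubeCount hA hA' hδ0) hδ.1)
  have htop : μH[s] A = ⊤ := by
    have h1 : ((s.toNNReal : ℝ≥0∞) : EReal) = s := by
      change ((ENNReal.ofReal s : ℝ≥0∞) : EReal) = s
      rw [EReal.coe_ennreal_ofReal, max_eq_left hs0.le]
    have h2 : (s.toNNReal : ℝ≥0∞) < dimH A := by
      rw [← h1] at hs2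
      exact EReal.coe_ennreal_lt_coe_ennreal_iff.1 hs2
    have h3 := hausdorffMeasure_of_lt_dimH h2
    rwa [Real.coe_toNNReal _ hs0.le] at h3
  rw [htop] at hle
  exact absurd (hle.trans hbound) (by simp)

theorem lowerBoxDim_le_upperBoxDim (A : Set (EuclideanSpace ℝ (Fin d))) :
    lowerBoxDim A ≤ upperBoxDim A :=
  liminf_le_limsup

/-- A set with at most `C * B ^ n` cubes of the `δ`-mesh for `r ^ (n + 1) < δ ≤ r ^ n` has
upper box dimension at most `log B / log r⁻¹`. -/
theorem upperBoxDim_le_of_cubeCount_le {A : Set (EuclideanSpace ℝ (Fin d))}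
    (hA : Bornology.IsBounded A) (hA' : A.Nonempty) {C B r : ℝ} (hB : 1 ≤ B) (hr : 0 < r)
    (hr1 : r < 1)
    (h : ∀ n : ℕ, ∀ δ : ℝ, r ^ (n + 1) < δ → δ ≤ r ^ n → (cubeCount A δ : ℝ) ≤ C * B ^ n) :
    upperBoxDim A ≤ ((Real.log B / (-Real.log r) : ℝ) : EReal) := by
  have hlr : 0 < -Real.log r := neg_pos.2 (Real.log_neg hr hr1)
  have hlB : 0 ≤ Real.log B := Real.log_nonneg hB
  -- The constant `C` only contributes `log C / (-log δ)`, which vanishes in the limit.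
  have hlim : Tendsto (fun δ : ℝ => Real.log C / (-Real.log δ) + Real.log B / (-Real.log r))
      (𝓝[>] 0) (𝓝 (0 + Real.log B / (-Real.log r))) :=
    ((tendsto_neg_atBot_atTop.comp Real.tendsto_log_nhdsGT_zero).const_div_atTop _).add_const _
  rw [zero_add] at hlim
  rw [← ((continuous_coe_real_ereal.tendsto _).comp hlim).limsup_eq]
  refine limsup_le_limsup ?_
  filter_upwards [Ioo_mem_nhdsGT one_pos] with δ hδ
  refine EReal.coe_le_coe_iff.2 ?_
  obtain ⟨n, hn, hn'⟩ := exists_nat_pow_near_of_lt_one hδ.1 hδ.2.le hr hr1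
  have hl : 0 < -Real.log δ := neg_pos.2 (Real.log_neg hδ.1 hδ.2)
  have hN : (0 : ℝ) < cubeCount A δ := by exact_mod_cast one_le_cubeCount hA hA' hδ.1
  have hNC := h n δ hn hn'
  have hBn : (0 : ℝ) < B ^ n := by positivity
  have hC : 0 < C := (pos_iff_pos_of_mul_pos (hN.trans_le hNC)).2 hBn
  have h1 : Real.log (cubeCount A δ) ≤ Real.log C + n * Real.log B := by
    rw [← Real.log_pow, ← Real.log_mul hC.ne' hBn.ne']
    exact Real.log_le_log hN hNC
  have h2 : n * -Real.log r ≤ -Real.log δ := by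
    have := Real.log_le_log hδ.1 hn'
    rw [Real.log_pow] at this
    linarith
  change _ ≤ Real.log C / -Real.log δ + Real.log B / -Real.log r
  rw [div_add_div _ _ hl.ne' hlr.ne', div_le_div_iff₀ hl (by positivity)]
  have h3 : n * -Real.log r * Real.log B ≤ -Real.log δ * Real.log B := by gcongr
  nlinarith [mul_le_mul_of_nonneg_right h1 (mul_pos hl hlr).le,
    mul_le_mul_of_nonneg_left h3 hl.le]

theorem cubeCount_le_sum {A : Set (EuclideanSpace ℝ (Fin d))} {ι : Type*} [Fintype ι]
    {S : ι → Set (EuclideanSpace ℝ (Fin d))} (hA : A ⊆ ⋃ i, S i) {lo hi : ι → Fin d → ℝ}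
    (hS : ∀ i, ∀ x ∈ S i, ∀ j, x j ∈ Icc (lo i j) (hi i j)) (hle : ∀ i j, lo i j ≤ hi i j)
    {δ : ℝ} (hδ : 0 < δ) :
    (cubeCount A δ : ℝ) ≤ ∑ i, ∏ j, ((hi i j - lo i j) / δ + 2) := by
  classical
  set F : ι → Finset (Fin d → ℤ) := fun i =>
    Fintype.piFinset fun j => Finset.Icc (⌈lo i j / δ⌉ - 1) ⌊hi i j / δ⌋
  have hsub : {m : Fin d → ℤ | (meshCube δ m ∩ A).Nonempty} ⊆
      (Finset.univ.biUnion F : Finset (Fin d → ℤ)) := by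
    rintro m ⟨x, hx, hxA⟩
    obtain ⟨i, hi⟩ := mem_iUnion.1 (hA hxA)
    exact Finset.mem_coe.2 (Finset.mem_biUnion.2 ⟨i, Finset.mem_univ _,
      mem_piFinset_of_meshCube_inter_nonempty hδ (hS i) ⟨x, hx, hi⟩⟩)
  calc (cubeCount A δ : ℝ) ≤ ((Finset.univ.biUnion F).card : ℝ) := by
        rw [← Set.ncard_coe_finset]
        exact_mod_cast Set.ncard_le_ncard hsub (Finset.finite_toSet _)
    _ ≤ ∑ i, ((F i).card : ℝ) := by exact_mod_cast Finset.card_biUnion_le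
    _ ≤ _ := by
        refine Finset.sum_le_sum fun i _ => ?_
        rw [Fintype.card_piFinset, Nat.cast_prod]
        exact Finset.prod_le_prod (fun j _ => Nat.cast_nonneg _)
          fun j _ => card_Icc_ceil_floor_le hδ (hle i j)

end BoxDim

/-! ### Oscillation on cells and the upper bound. -/

namespace SG

variable {p : Fin 3 → Plane} {N : ℕ}

theorem abs_le_supNorm {h : Plane → ℝ} (hh : ContinuousOn h (gasket p)) {t : Plane}
    (ht : t ∈ gasket p) : |h t| ≤ supNorm p h :=
  le_csSup ((isCompact_gasket p).image_of_continuousOn hh.abs).bddAbove ⟨t, ht, rfl⟩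

theorem supNorm_nonneg (h : Plane → ℝ) : 0 ≤ supNorm p h :=
  Real.sSup_nonneg (by rintro _ ⟨t, _, rfl⟩; exact abs_nonneg _)

theorem scalingSum_le (α : (Fin N → Fin 3) → Plane → ℝ) :
    scalingSum p α ≤ 3 ^ N * scalingMax p α := by
  have h := Finset.sum_le_card_nsmul Finset.univ (fun ω => supNorm p (α ω)) (scalingMax p α)
    fun ω _ => le_ciSup (f := fun ω => supNorm p (α ω)) (finite_range _).bddAbove ω
  simpa [scalingSum] using h

theorem le_scalingSum (α : (Fin N → Fin 3) → Plane → ℝ) :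
    3 ^ N * scalingMin p α ≤ scalingSum p α := by
  have h := Finset.card_nsmul_le_sum Finset.univ (fun ω => supNorm p (α ω)) (scalingMin p α)
    fun ω _ => ciInf_le (f := fun ω => supNorm p (α ω)) (finite_range _).bddBelow ω
  simpa [scalingSum] using h

theorem wordMap_succ (ω : Fin (N + 1) → Fin 3) (t : Plane) :
    wordMap p ω t = L p (ω 0) (wordMap p (fun i => ω i.succ) t) := by
  simp [wordMap, List.ofFn_succ]

theorem dist_wordMap (ω : Fin N → Fin 3) (x y : Plane) :
    dist (wordMap p ω x) (wordMap p ω y) = (1 / 2 : ℝ) ^ N * dist x y := by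
  induction N with
  | zero => simp [wordMap]
  | succ N ih => rw [wordMap_succ, wordMap_succ, dist_L, ih, pow_succ]; ring

theorem wordMap_mem_gasket (ω : Fin N → Fin 3) {x : Plane} (hx : x ∈ gasket p) :
    wordMap p ω x ∈ gasket p := by
  induction N with
  | zero => simpa [wordMap] using hx
  | succ N ih =>
    rw [wordMap_succ, gasket_eq_iUnion]
    exact mem_iUnion.2 ⟨_, _, ih _, rfl⟩

theorem point_eq_wordMap (w : ℕ → Fin 3) (N : ℕ) :
    point p w = wordMap p (fun i : Fin N => w i) (point p fun k => w (k + N)) := by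
  induction N generalizing w with
  | zero => simp [wordMap]
  | succ N ih =>
    rw [wordMap_succ, point_eq, ih]
    simp only [Fin.val_zero, Fin.val_succ, add_assoc]

theorem exists_wordMap_eq (N : ℕ) {x : Plane} (hx : x ∈ gasket p) :
    ∃ ω : Fin N → Fin 3, ∃ y ∈ gasket p, wordMap p ω y = x := by
  obtain ⟨w, rfl⟩ := hx
  exact ⟨_, _, ⟨_, rfl⟩, (point_eq_wordMap w N).symm⟩

/-- Since `r ^ n ≤ 1`, the exponent may be lowered to the common `σ`. The factor `D` may exceed `1`
and keeps its own exponent. -/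
theorem abs_sub_le_of_holderOnWith {K s : ℝ≥0} {G : Set Plane} {h : Plane → ℝ}
    (hh : HolderOnWith K s h G) {σ : ℝ} (hσ : σ ≤ s) {D r : ℝ} (hD : 0 ≤ D) (hr : 0 < r)
    (hr1 : r ≤ 1) {n : ℕ} {x y : Plane} (hx : x ∈ G) (hy : y ∈ G) (hxy : dist x y ≤ D * r ^ n) :
    |h x - h y| ≤ K * D ^ (s : ℝ) * (r ^ σ) ^ n := by
  rw [← Real.dist_eq]
  calc dist (h x) (h y) ≤ K * (D * r ^ n) ^ (s : ℝ) := hh.dist_le_of_le hx hy hxy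
    _ = K * D ^ (s : ℝ) * (r ^ n) ^ (s : ℝ) := by
        rw [Real.mul_rpow hD (by positivity), mul_assoc]
    _ ≤ K * D ^ (s : ℝ) * (r ^ n) ^ σ := by
        have := Real.rpow_le_rpow_of_exponent_ge (by positivity) (pow_le_one₀ hr.le hr1 (n := n)) hσ
        gcongr
    _ = K * D ^ (s : ℝ) * (r ^ σ) ^ n := by
        rw [← Real.rpow_natCast, ← Real.rpow_natCast, ← Real.rpow_mul hr.le, ← Real.rpow_mul hr.le,
          mul_comm σ]

/-- The self-referential equation bounds the oscillation of a fractal function on a cell by that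
on the parent cell, up to a geometric error. -/
theorem exists_abs_sub_wordMap_le {f b g : Plane → ℝ} {α : (Fin N → Fin 3) → Plane → ℝ}
    {K_f K_b K_α σ_f σ_b σ_α : ℝ≥0} (hσ_b : 0 < σ_b) (hσ_α : 0 < σ_α)
    (hf : HolderOnWith K_f σ_f f (gasket p)) (hb : HolderOnWith K_b σ_b b (gasket p))
    (hα : ∀ ω, HolderOnWith K_α σ_α (α ω) (gasket p)) (hα_lt : ∀ ω, supNorm p (α ω) < 1)
    {σ : ℝ} (hf' : σ ≤ σ_f) (hb' : σ ≤ σ_b) (hα' : σ ≤ σ_α)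
    (hg : IsAlphaFractalFunction p f b α g) {D r : ℝ} (hD : 0 ≤ D) (hr : 0 < r) (hr1 : r ≤ 1) :
    ∃ E : ℝ, 0 ≤ E ∧ ∀ (n : ℕ) (ω : Fin N → Fin 3), ∀ x ∈ gasket p, ∀ y ∈ gasket p,
      dist x y ≤ D * r ^ n → |g (wordMap p ω x) - g (wordMap p ω y)| ≤
        supNorm p (α ω) * |g x - g y| + E * (r ^ σ) ^ n := by
  have hgb : ContinuousOn (fun t => g t - b t) (gasket p) :=
    hg.continuousOn.sub (hb.continuousOn hσ_b)
  set B := supNorm p fun t => g t - b t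
  have hB : 0 ≤ B := supNorm_nonneg _
  refine ⟨K_f * D ^ (σ_f : ℝ) + K_b * D ^ (σ_b : ℝ) + B * (K_α * D ^ (σ_α : ℝ)), by positivity,
    fun n ω x hx y hy hxy => ?_⟩
  have hxy' : dist (wordMap p ω x) (wordMap p ω y) ≤ D * r ^ n := by
    rw [dist_wordMap]
    exact (mul_le_of_le_one_left dist_nonneg
      (pow_le_one₀ (by norm_num) (by norm_num))).trans hxy
  have h1 := abs_sub_le_of_holderOnWith hf hf' hD hr hr1 (wordMap_mem_gasket ω hx)
    (wordMap_mem_gasket ω hy) hxy'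
  have h2 := abs_sub_le_of_holderOnWith hb hb' hD hr hr1 hx hy hxy
  have h3 := abs_sub_le_of_holderOnWith (hα ω) hα' hD hr hr1 hx hy hxy
  have h4 : |α ω x| ≤ supNorm p (α ω) := abs_le_supNorm ((hα ω).continuousOn hσ_α) hx
  have h5 : |g y - b y| ≤ B := abs_le_supNorm hgb hy
  -- The products are split so that `g x - g y` carries only the factor `α ω x`; every other term is
  -- a Hölder increment times a bounded factor.
  have e : g (wordMap p ω x) - g (wordMap p ω y) = (f (wordMap p ω x) - f (wordMap p ω y)) +
      α ω x * (g x - g y) - α ω x * (b x - b y) + (g y - b y) * (α ω x - α ω y) := by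
    rw [hg.self_referential ω x hx, hg.self_referential ω y hy]
    ring
  calc |g (wordMap p ω x) - g (wordMap p ω y)|
      ≤ |f (wordMap p ω x) - f (wordMap p ω y)| + |α ω x| * |g x - g y| +
        |α ω x| * |b x - b y| + |g y - b y| * |α ω x - α ω y| := by
        rw [e, ← abs_mul, ← abs_mul, ← abs_mul]
        refine (abs_add_le _ _).trans (add_le_add_left ((abs_sub _ _).trans ?_) _)
        exact add_le_add_left (abs_add_le _ _) _
    _ ≤ K_f * D ^ (σ_f : ℝ) * (r ^ σ) ^ n + supNorm p (α ω) * |g x - g y| +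
        1 * (K_b * D ^ (σ_b : ℝ) * (r ^ σ) ^ n) + B * (K_α * D ^ (σ_α : ℝ) * (r ^ σ) ^ n) := by
        gcongr
        exact h4.trans (hα_lt ω).le
    _ = _ := by ring

/-- The cells of level `n` together with bounds for the oscillation of `g` on them. -/
theorem exists_cells {g : Plane → ℝ} (hg : ContinuousOn g (gasket p)) {D E θ β : ℝ}
    (hD : ∀ x ∈ gasket p, ∀ y ∈ gasket p, dist x y ≤ D)
    {a : (Fin N → Fin 3) → ℝ} (ha : ∀ ω, 0 ≤ a ω) (haβ : ∑ ω, a ω ≤ β)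
    (hE : 0 ≤ E) (hθ : 0 ≤ θ) (hβ : 3 ^ N * θ < β)
    (h : ∀ (n : ℕ) (ω : Fin N → Fin 3), ∀ x ∈ gasket p, ∀ y ∈ gasket p,
      dist x y ≤ D * ((1 / 2 : ℝ) ^ N) ^ n → |g (wordMap p ω x) - g (wordMap p ω y)| ≤
        a ω * |g x - g y| + E * θ ^ n) :
    ∃ M : ℝ, ∀ n : ℕ, ∃ (ι : Type) (_ : Fintype ι) (S : ι → Set Plane) (O : ι → ℝ),
      Fintype.card ι = (3 ^ N) ^ n ∧ gasket p = ⋃ i, S i ∧ (∀ i, (S i).Nonempty) ∧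
      (∀ i, ∀ x ∈ S i, ∀ y ∈ S i, dist x y ≤ D * ((1 / 2 : ℝ) ^ N) ^ n) ∧
      (∀ i, ∀ x ∈ S i, ∀ y ∈ S i, |g x - g y| ≤ O i) ∧ ∑ i, O i ≤ M * β ^ n := by
  set q : ℝ := 3 ^ N * θ
  set c : ℝ := 3 ^ N * E / (β - q)
  have hβq : 0 < β - q := sub_pos.2 hβ
  have hc : c * (β - q) = 3 ^ N * E := div_mul_cancel₀ _ hβq.ne'
  have hc0 : 0 ≤ c := by positivity
  have hq : 0 ≤ q := by positivity
  set R : ℝ := 2 * supNorm p g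
  -- The term `- c * q ^ n` makes the induction close: `c` is chosen so that `- c * q ^ n` solves
  -- the recursion `T (n + 1) = β * T n + 3 ^ N * E * q ^ n` exactly.
  suffices H : ∀ n : ℕ, ∃ (ι : Type) (_ : Fintype ι) (S : ι → Set Plane) (O : ι → ℝ),
      Fintype.card ι = (3 ^ N) ^ n ∧ gasket p = ⋃ i, S i ∧ (∀ i, (S i).Nonempty) ∧
      (∀ i, ∀ x ∈ S i, ∀ y ∈ S i, dist x y ≤ D * ((1 / 2 : ℝ) ^ N) ^ n) ∧
      (∀ i, ∀ x ∈ S i, ∀ y ∈ S i, |g x - g y| ≤ O i) ∧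
      ∑ i, O i ≤ (R + c) * β ^ n - c * q ^ n by
    refine ⟨R + c, fun n => ?_⟩
    obtain ⟨ι, hι, S, O, h1, h2, h3, h4, h5, h6⟩ := H n
    exact ⟨ι, hι, S, O, h1, h2, h3, h4, h5, h6.trans (sub_le_self _ (by positivity))⟩
  intro n
  induction n with
  | zero =>
    refine ⟨Unit, inferInstance, fun _ => gasket p, fun _ => R, by simp, (iUnion_const _).symm,
      fun _ => gasket_nonempty p, fun _ x hx y hy => by simpa using hD x hx y hy,
      fun _ x hx y hy => ?_, by simp⟩
    have h1 := abs_le_supNorm hg hx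
    have h2 := abs_le_supNorm hg hy
    have h3 := abs_sub (g x) (g y)
    simp only [R]
    linarith
  | succ n ih =>
    obtain ⟨ι, hι, S, O, h1, h2, h3, h4, h5, h6⟩ := ih
    have hS : ∀ i, S i ⊆ gasket p := fun i => h2 ▸ subset_iUnion S i
    -- The new word is applied outermost, which is the form in which the self-referential equation
    -- compares a cell with an old one.
    refine ⟨(Fin N → Fin 3) × ι, inferInstance, fun i => wordMap p i.1 '' S i.2,
      fun i => a i.1 * O i.2 + E * θ ^ n, ?_, ?_, fun i => (h3 i.2).image _, ?_, ?_, ?_⟩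
    · simp [Fintype.card_prod, h1, pow_succ']
    · refine Subset.antisymm (fun x hx => ?_) (iUnion_subset fun i => ?_)
      · obtain ⟨ω, y, hy, rfl⟩ := exists_wordMap_eq N hx
        rw [h2] at hy
        obtain ⟨i, hi⟩ := mem_iUnion.1 hy
        exact mem_iUnion.2 ⟨(ω, i), y, hi, rfl⟩
      · rintro _ ⟨x, hx, rfl⟩
        exact wordMap_mem_gasket _ (hS _ hx)
    · rintro i _ ⟨x, hx, rfl⟩ _ ⟨y, hy, rfl⟩
      rw [dist_wordMap, pow_succ', mul_left_comm]
      gcongr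
      exact h4 _ x hx y hy
    · rintro i _ ⟨x, hx, rfl⟩ _ ⟨y, hy, rfl⟩
      refine (h n i.1 x (hS _ hx) y (hS _ hy) (h4 _ x hx y hy)).trans ?_
      have := mul_le_mul_of_nonneg_left (h5 _ x hx y hy) (ha i.1)
      linarith
    · have hO : 0 ≤ ∑ i, O i := Finset.sum_nonneg fun i _ => by
        obtain ⟨x, hx⟩ := h3 i
        exact (abs_nonneg _).trans (h5 i x hx x hx)
      have hβ0 : 0 ≤ β := hq.trans hβ.le
      calc ∑ i : (Fin N → Fin 3) × ι, (a i.1 * O i.2 + E * θ ^ n)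
          = (∑ ω, a ω) * ∑ i, O i + 3 ^ N * E * q ^ n := by
            rw [Finset.sum_add_distrib, Fintype.sum_prod_type, Finset.sum_mul_sum,
              Finset.sum_const, Finset.card_univ, Fintype.card_prod, h1]
            simp only [Fintype.card_fun, Fintype.card_fin, nsmul_eq_mul, q, mul_pow]
            push_cast
            ring
        _ ≤ β * ((R + c) * β ^ n - c * q ^ n) + 3 ^ N * E * q ^ n := by gcongr
        _ = (R + c) * β ^ (n + 1) - c * q ^ (n + 1) := by
            rw [← hc]
            ring

theorem isBounded_graph {g : Plane → ℝ} (hg : ContinuousOn g (gasket p)) :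
    Bornology.IsBounded (graph p g) := by
  refine ((isCompact_gasket p).image_of_continuousOn ?_).isBounded
  refine (PiLp.continuous_toLp 2 _).comp_continuousOn (continuousOn_pi.2 fun i => ?_)
  fin_cases i
  · exact (EuclideanSpace.proj (𝕜 := ℝ) (0 : Fin 2)).continuous.continuousOn
  · exact (EuclideanSpace.proj (𝕜 := ℝ) (1 : Fin 2)).continuous.continuousOn
  · exact hg

theorem graph_nonempty (g : Plane → ℝ) : (graph p g).Nonempty := (gasket_nonempty p).image _

theorem abs_apply_sub_le_dist (x y : Plane) (i : Fin 2) : |x i - y i| ≤ dist x y := by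
  rw [dist_eq_norm]
  exact PiLp.norm_apply_le (x - y) i

/-- Over each cell the graph lies in a box about one of its points with half-widths `ρ, ρ, O i`. -/
theorem cubeCount_graph_le {g : Plane → ℝ} {ι : Type} [Fintype ι] {S : ι → Set Plane}
    {O : ι → ℝ} {ρ δ : ℝ} (hρ : 0 ≤ ρ) (hδ : 0 < δ) (hS : gasket p = ⋃ i, S i)
    (hne : ∀ i, (S i).Nonempty) (hd : ∀ i, ∀ x ∈ S i, ∀ y ∈ S i, dist x y ≤ ρ)
    (ho : ∀ i, ∀ x ∈ S i, ∀ y ∈ S i, |g x - g y| ≤ O i) :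
    (BoxDim.cubeCount (graph p g) δ : ℝ) ≤
      (2 * ρ / δ + 2) ^ 2 * (2 / δ * ∑ i, O i + 2 * Fintype.card ι) := by
  choose z hz using hne
  have hO : ∀ i, 0 ≤ O i := fun i => (abs_nonneg _).trans (ho i _ (hz i) _ (hz i))
  have key := BoxDim.cubeCount_le_sum (A := graph p g)
    (S := fun i => (fun t : Plane => !₂[t 0, t 1, g t]) '' S i)
    (lo := fun i => ![z i 0 - ρ, z i 1 - ρ, g (z i) - O i])
    (hi := fun i => ![z i 0 + ρ, z i 1 + ρ, g (z i) + O i])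
    (by rw [graph, hS, image_iUnion]) ?_ ?_ hδ
  · refine key.trans (le_of_eq ?_)
    rw [Finset.mul_sum, mul_comm 2 (Fintype.card ι : ℝ), ← nsmul_eq_mul, ← Finset.card_univ,
      ← Finset.sum_const, ← Finset.sum_add_distrib, Finset.mul_sum]
    refine Finset.sum_congr rfl fun i _ => ?_
    simp only [Fin.prod_univ_three]
    simp
    ring
  · rintro i _ ⟨x, hx, rfl⟩ j
    have h0 := abs_le.1 ((abs_apply_sub_le_dist x (z i) 0).trans (hd i x hx _ (hz i)))
    have h1 := abs_le.1 ((abs_apply_sub_le_dist x (z i) 1).trans (hd i x hx _ (hz i)))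
    have h2 := abs_le.1 (ho i x hx _ (hz i))
    fin_cases j
    · simp
      constructor <;> linarith
    · simp
      constructor <;> linarith
    · simp
      constructor <;> linarith
  · intro i j
    have := hO i
    fin_cases j <;> simp <;> linarith

/-- Leaving `β` free lets one estimate serve both parts of the theorem. -/
theorem upperBoxDim_graph_le (hN : 1 ≤ N) {f b g : Plane → ℝ} {α : (Fin N → Fin 3) → Plane → ℝ}
    {K_f K_b K_α σ_f σ_b σ_α : ℝ≥0} (hσ_b : 0 < σ_b) (hσ_α : 0 < σ_α)
    (hf : HolderOnWith K_f σ_f f (gasket p)) (hb : HolderOnWith K_b σ_b b (gasket p))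
    (hα : ∀ ω, HolderOnWith K_α σ_α (α ω) (gasket p)) (hα_lt : ∀ ω, supNorm p (α ω) < 1)
    {σ : ℝ} (hf' : σ ≤ σ_f) (hb' : σ ≤ σ_b) (hα' : σ ≤ σ_α) (hσ1 : σ ≤ 1)
    (hg : IsAlphaFractalFunction p f b α g) {β : ℝ} (hαβ : scalingSum p α ≤ β)
    (hβ : 3 ^ N * (1 / (2 : ℝ) ^ ((N : ℝ) * σ)) < β) :
    BoxDim.upperBoxDim (graph p g) ≤
      ((1 + Real.log β / ((N : ℝ) * Real.log 2) : ℝ) : EReal) := by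
  set r : ℝ := (1 / 2 : ℝ) ^ N
  have hr : 0 < r := by positivity
  have hr1 : r < 1 := pow_lt_one₀ (by norm_num) (by norm_num) (by omega)
  have hθ : r ^ σ = 1 / (2 : ℝ) ^ ((N : ℝ) * σ) := by
    rw [← Real.rpow_natCast_mul (by norm_num), one_div, one_div, Real.inv_rpow (by norm_num)]
  rw [← hθ] at hβ
  have hrσ : r ≤ r ^ σ := by
    simpa using Real.rpow_le_rpow_of_exponent_ge hr hr1.le hσ1
  have hβ0 : 0 < β := lt_of_le_of_lt (by positivity) hβ
  -- The number of cells grows no faster than the oscillation term; this is where `σ ≤ 1` enters,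
  -- through `r ≤ r ^ σ`.
  have h3 : (3 : ℝ) ^ N ≤ β / r := by
    rw [le_div_iff₀ hr]
    exact (mul_le_mul_of_nonneg_left hrσ (by positivity)).trans hβ.le
  obtain ⟨D, hD⟩ := Metric.isBounded_iff.1 (isCompact_gasket p).isBounded
  have hD0 : 0 ≤ D := by
    obtain ⟨x, hx⟩ := gasket_nonempty p
    exact dist_nonneg.trans (hD hx hx)
  obtain ⟨E, hE, hosc⟩ := exists_abs_sub_wordMap_le hσ_b hσ_α hf hb hα hα_lt hf' hb' hα' hg
    hD0 hr hr1.le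
  obtain ⟨M, hM⟩ := exists_cells hg.continuousOn (fun x hx y hy => hD hx hy)
    (fun ω => supNorm_nonneg (α ω)) hαβ hE (by positivity) hβ hosc
  have hbound := BoxDim.upperBoxDim_le_of_cubeCount_le (isBounded_graph hg.continuousOn)
    (graph_nonempty g) (C := (2 * D / r + 2) ^ 2 * (2 * M / r + 2)) (B := β / r)
    ((one_le_pow₀ (by norm_num)).trans h3) hr hr1 ?_
  · refine hbound.trans (le_of_eq ?_)
    have hl : Real.log r = -(N * Real.log 2) := by
      rw [Real.log_pow, one_div, Real.log_inv]
      ring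
    have hN' : (0 : ℝ) < N := by exact_mod_cast hN
    have hl2 : 0 < Real.log 2 := Real.log_pos (by norm_num)
    rw [Real.log_div hβ0.ne' hr.ne', hl]
    congr 1
    field_simp
    ring
  · intro n δ hn hn'
    have hδ : 0 < δ := lt_trans (by positivity) hn
    obtain ⟨ι, hι, S, O, h1, h2, h3', h4, h5, h6⟩ := hM n
    have hO : 0 ≤ ∑ i, O i := Finset.sum_nonneg fun i _ => by
      obtain ⟨x, hx⟩ := h3' i
      exact (abs_nonneg _).trans (h5 i x hx x hx)
    have hrn : 0 < r ^ (n + 1) := by positivity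
    calc (BoxDim.cubeCount (graph p g) δ : ℝ)
        ≤ (2 * (D * r ^ n) / δ + 2) ^ 2 * (2 / δ * ∑ i, O i + 2 * Fintype.card ι) :=
          cubeCount_graph_le (by positivity) hδ h2 h3' h4 h5
      _ ≤ (2 * (D * r ^ n) / r ^ (n + 1) + 2) ^ 2 *
          (2 / r ^ (n + 1) * (M * β ^ n) + 2 * (β / r) ^ n) := by
          rw [h1]
          push_cast
          gcongr
      _ = (2 * D / r + 2) ^ 2 * (2 * M / r + 2) * (β / r) ^ n := by
          rw [div_pow]
          field_simp
          ring

end SG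

/-! ### Assembly of the two chains of inequalities. -/

theorem mainTheorem1 (p : Fin 3 → Plane) (hp : SG.IsEquilateral p) (N : ℕ) (hN : 1 ≤ N)
    (f b : Plane → ℝ) (α : (Fin N → Fin 3) → Plane → ℝ)
    (K_f K_b K_α σ_f σ_b σ_α : ℝ≥0)
    (hσ_f : 0 < σ_f ∧ σ_f ≤ 1) (hσ_b : 0 < σ_b ∧ σ_b ≤ 1) (hσ_α : 0 < σ_α ∧ σ_α ≤ 1)
    (hf : HolderOnWith K_f σ_f f (SG.gasket p))
    (hb : HolderOnWith K_b σ_b b (SG.gasket p))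
    (hα : ∀ ω, HolderOnWith K_α σ_α (α ω) (SG.gasket p))
    (hbf : ∀ j, b (p j) = f (p j))
    (hα_lt : ∀ ω, SG.supNorm p (α ω) < 1)
    (σ : ℝ) (hσ : σ = min (σ_f : ℝ) (min (σ_b : ℝ) (σ_α : ℝ)))
    (g : Plane → ℝ) (hg : SG.IsAlphaFractalFunction p f b α g) :
    (1 / (2 : ℝ) ^ ((N : ℝ) * σ) < SG.scalingMin p α →
      ((Real.log 3 / Real.log 2 : ℝ) : EReal) ≤ (dimH (SG.graph p g) : EReal) ∧
      (dimH (SG.graph p g) : EReal) ≤ BoxDim.lowerBoxDim (SG.graph p g) ∧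
      BoxDim.lowerBoxDim (SG.graph p g) ≤ BoxDim.upperBoxDim (SG.graph p g) ∧
      BoxDim.upperBoxDim (SG.graph p g) ≤
        ((1 + Real.log (SG.scalingSum p α) / ((N : ℝ) * Real.log 2) : ℝ) : EReal)) ∧
    (1 / (2 : ℝ) ^ ((N : ℝ) * σ) < SG.scalingMax p α → SG.scalingMax p α < 1 →
      ((Real.log 3 / Real.log 2 : ℝ) : EReal) ≤ (dimH (SG.graph p g) : EReal) ∧
      (dimH (SG.graph p g) : EReal) ≤ BoxDim.lowerBoxDim (SG.graph p g) ∧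
      BoxDim.lowerBoxDim (SG.graph p g) ≤ BoxDim.upperBoxDim (SG.graph p g) ∧
      BoxDim.upperBoxDim (SG.graph p g) ≤
        ((1 + Real.log ((3 : ℝ) ^ N * SG.scalingMax p α) / ((N : ℝ) * Real.log 2) : ℝ) :
          EReal)) := by
  have hf' : σ ≤ σ_f := hσ ▸ min_le_left _ _
  have hb' : σ ≤ σ_b := hσ ▸ (min_le_right _ _).trans (min_le_left _ _)
  have hα' : σ ≤ σ_α := hσ ▸ (min_le_right _ _).trans (min_le_right _ _)
  have hσ1 : σ ≤ 1 := hf'.trans (by exact_mod_cast hσ_f.2)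
  have hlow : ((Real.log 3 / Real.log 2 : ℝ) : EReal) ≤ (dimH (SG.graph p g) : EReal) := by
    have h := EReal.coe_ennreal_le_coe_ennreal_iff.2 (SG.log_three_div_log_two_le_dimH_graph hp g)
    rw [EReal.coe_ennreal_ofReal] at h
    exact (EReal.coe_le_coe_iff.2 (le_max_left _ _)).trans h
  have hbox := BoxDim.dimH_le_lowerBoxDim (SG.isBounded_graph hg.continuousOn)
    (SG.graph_nonempty g)
  have hup : ∀ β : ℝ, SG.scalingSum p α ≤ β → 3 ^ N * (1 / (2 : ℝ) ^ ((N : ℝ) * σ)) < β →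
      BoxDim.upperBoxDim (SG.graph p g) ≤
        ((1 + Real.log β / ((N : ℝ) * Real.log 2) : ℝ) : EReal) :=
    fun β => SG.upperBoxDim_graph_le hN hσ_b.1 hσ_α.1 hf hb hα hα_lt hf' hb' hα' hσ1 hg
  refine ⟨fun h => ⟨hlow, hbox, BoxDim.lowerBoxDim_le_upperBoxDim _, hup _ le_rfl ?_⟩,
    fun h _ => ⟨hlow, hbox, BoxDim.lowerBoxDim_le_upperBoxDim _, hup _ (SG.scalingSum_le α) ?_⟩⟩
  -- Here `β = γ̃ ≥ 3 ^ N * α_min`, so the condition on `α_min` gives the strict growth gap.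
  · exact (mul_lt_mul_of_pos_left h (by positivity)).trans_le (SG.le_scalingSum α)
  · exact mul_lt_mul_of_pos_left h (by positivity)
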